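/- Let $d\ge 1$, let $K\subset\mathbb R^d$ be a full-dimensional simple polytope (a convex polytope with non-empty interior, each vertex of which lies on exactly $d$ facets), and let $(X_1,Y_1),\dots,(X_n,Y_n),(X,Y)$ be i.i.d. with values in $\mathbb R^d\times\{0,1\}$, where the marginal distribution $\mu$ of $X$ is the uniform distribution on $K$. Let $\eta(x)=\mathbb P(Y=1\mid X=x)$, let $f^*(x)=\mathbf 1\{\eta(x)>1/2\}$ be the Bayes classifier, and let $R(f)=\mathbb P(f(X)\ne Y)$ denote the zero-one risk. Given points $x_1,\dots,x_n$ that affinely span $\mathbb R^d$, let $T$ be a Delaunay triangulation of them: a subdivision of their convex hull $\widehat C$ into non-degenerate simplices with vertices among the $x_i$, any two of which intersect in their common face, such that the Voronoi cells of the vertices of each simplex have a common point (that is, no $x_i$ lies in the open circumscribed ball of a simplex). The triangulation depends on the $x_i$ only, not on the labels. The simplicial interpolant $\hat\eta$ of $(x_1,y_1),\dots,(x_n,y_n)$ is, on each simplex of $T$, the affine function that takes the values $y_i$ at the vertices $x_i$ of the simplex, and $\hat\eta(x)=1/2$ for $x\notin\widehat C$. Let $\hat f(x)=\mathbf 1\{\hat\eta(x)>1/2\}$,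 built from the training data $(X_1,Y_1),\dots,(X_n,Y_n)$. Assume that 1. ($h$-hard margin) $|\eta(x)-1/2|\ge h>0$ for all $x\in\operatorname{supp}(\mu)$; 2. $\eta$ is Lipschitz away from the class boundary, i.e. it is Lipschitz on $\{x\in\operatorname{supp}(\mu):\eta(x)<1/2\}$ and on $\{x\in\operatorname{supp}(\mu):\eta(x)>1/2\}$; 3. the class boundary $\partial=\overline{\{x\in\operatorname{supp}(\mu):f^*(x)=0\}}\cap\overline{\{x\in\operatorname{supp}(\mu):f^*(x)=1\}}$ satisfies $\lim_{\epsilon\downarrow 0}\mu\big(\partial+B(0,\epsilon)\big)=0$, where $B(0,\epsilon)$ is the closed Euclidean ball and $+$ is the Minkowski sum. Then there are constants $c_1,c_2>0$, depending only on $h$ (in particular not on $d$, $K$ or the distribution of $(X,Y)$), such that $$\limsup_{n\to\infty}\mathbb E[R(\hat f)]\le R(f^*)\,\bigl(1+c_1e^{-c_2d}\bigr).$$ -/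

import Mathlib

open MeasureTheory ProbabilityTheory Filter Topology Set
open scoped ENNReal NNReal Pointwise

noncomputable section

namespace SimplicialInterpolation

/-- Euclidean space `ℝ^d`. -/
abbrev E (d : ℕ) : Type := EuclideanSpace ℝ (Fin d)

/-! ### Simple polytopes -/

/-- A facet of a convex set `K ⊆ ℝ^d`: a nonempty exposed face of dimension `d - 1`. -/
def IsFacet {d : ℕ} (K F : Set (E d)) : Prop :=
  IsExposed ℝ K F ∧ F.Nonempty ∧ Module.finrank ℝ (vectorSpan ℝ F) + 1 = d

/-- A full-dimensional convex polytope in `ℝ^d` each of whose vertices lies on exactly `d` facets. -/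
structure IsSimplePolytope {d : ℕ} (K : Set (E d)) : Prop where
  polytope : ∃ V : Set (E d), V.Finite ∧ K = convexHull ℝ V
  fullDim : (interior K).Nonempty
  simple : ∀ v ∈ K.extremePoints ℝ, {F : Set (E d) | IsFacet K F ∧ v ∈ F}.ncard = d

/-! ### Delaunay triangulations -/

/-- The Voronoi cell of the `i`-th point of the configuration `x`. -/
def voronoiCell {d n : ℕ} (x : Fin n → E d) (i : Fin n) : Set (E d) :=
  {p | ∀ j, dist p (x i) ≤ dist p (x j)}

/-- `T` is a Delaunay triangulation of the points `x 0, …, x (n - 1)`: a subdivision of their convex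
hull into non-degenerate simplices with vertices among these points (a simplex is given by the
indices of its `d + 1` vertices), any two of which meet in their common face, and such that the
Voronoi cells of the vertices of each simplex have a common point (equivalently, the open ball
bounded by the circumsphere of each simplex contains none of the points). -/
structure IsDelaunayTriangulation {d n : ℕ} (x : Fin n → E d) (T : Set (Finset (Fin n))) :
    Prop where
  card_eq : ∀ s ∈ T, s.card = d + 1
  nondegenerate : ∀ s ∈ T, AffineIndependent ℝ (fun i : s => x i)
  cover : ⋃ s ∈ T, convexHull ℝ (x '' s) = convexHull ℝ (range x)
  inter : ∀ s ∈ T, ∀ t ∈ T,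
    convexHull ℝ (x '' s) ∩ convexHull ℝ (x '' t) = convexHull ℝ (x '' (s ∩ t : Set (Fin n)))
  delaunay : ∀ s ∈ T, ∃ c : E d, ∀ i ∈ s, c ∈ voronoiCell x i

/-- A triangulation scheme: a set of simplices for each configuration of unlabeled examples. -/
abbrev TriangulationScheme (d : ℕ) : Type :=
  ∀ n : ℕ, (Fin n → E d) → Set (Finset (Fin n))

/-- The scheme returns a Delaunay triangulation for each configuration that spans `ℝ^d`. -/
def TriangulationScheme.IsDelaunay {d : ℕ} (T : TriangulationScheme d) : Prop :=
  ∀ (n : ℕ) (x : Fin n → E d), affineSpan ℝ (range x) = ⊤ → IsDelaunayTriangulation x (T n x)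

/-! ### Simplicial interpolation -/

open Classical in
/-- The linear interpolation of the data `(v i, y i)`, `i ∈ s`, at `p`: the value `β₀ + ⟨p, β⟩`, where
`(β₀, β)` solves `β₀ + ⟨v i, β⟩ = y i` for all `i ∈ s`. If `s` indexes the vertices of a
non-degenerate simplex, there is exactly one solution. -/
def linearInterpolation {d n : ℕ} (v : Fin n → E d) (y : Fin n → ℝ) (s : Finset (Fin n)) (p : E d) :
    ℝ :=
  if hb : ∃ b : ℝ × E d, ∀ i ∈ s, b.1 + inner ℝ (v i) b.2 = y i then
    hb.choose.1 + inner ℝ p hb.choose.2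
  else 0

open Classical in
/-- The simplicial interpolant of the data `(x i, y i)` for the set `T` of simplices: at `p` it is
the linear interpolation over a simplex of `T` that contains `p`, and `1 / 2` if there is none. -/
def simplicialInterpolant {d n : ℕ} (T : Set (Finset (Fin n))) (x : Fin n → E d) (y : Fin n → ℝ)
    (p : E d) : ℝ :=
  if hs : ∃ s : Finset (Fin n), s ∈ T ∧ p ∈ convexHull ℝ (x '' s) then
    linearInterpolation x y hs.choose p
  else 1 / 2

/-! ### Classification; labels are elements of `Fin 2`, that is `0` or `1` -/

/-- A label as a real number. -/
def label (y : Fin 2) : ℝ := ((y : ℕ) : ℝ)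

open Classical in
/-- The plug-in classifier `p ↦ 𝟙{g p > 1/2}`. For the conditional mean function `g = η` it is the
Bayes optimal classifier. -/
def plugin {d : ℕ} (g : E d → ℝ) (p : E d) : Fin 2 := if 1 / 2 < g p then 1 else 0

/-- The plug-in classifier based on simplicial interpolation of the labeled examples `z`. -/
def simplicialClassifier {d n : ℕ} (T : TriangulationScheme d) (z : Fin n → E d × Fin 2) :
    E d → Fin 2 :=
  plugin (simplicialInterpolant (T n fun i => (z i).1) (fun i => (z i).1) fun i => label (z i).2)

/-- The zero-one risk `P(f(X) ≠ Y)`, where `(X, Y)` has law `P`. -/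
def risk {d : ℕ} (P : Measure (E d × Fin 2)) (f : E d → Fin 2) : ℝ≥0∞ :=
  P {z | f z.1 ≠ z.2}

/-- The expected risk of the simplicial interpolation classifier trained on `n` independent examples
with law `P`. -/
def expectedRisk {d : ℕ} (P : Measure (E d × Fin 2)) (T : TriangulationScheme d) (n : ℕ) : ℝ≥0∞ :=
  ∫⁻ z, risk P (simplicialClassifier T z) ∂(Measure.pi fun _ : Fin n => P)

/-- `η` is (a version of) the conditional mean `x ↦ E(Y | X = x)`, where `(X, Y)` has law `P`. -/
def IsConditionalMean {d : ℕ} (P : Measure (E d × Fin 2)) (η : E d → ℝ) : Prop :=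
  Measurable η ∧
    P[fun z => label z.2 | MeasurableSpace.comap Prod.fst inferInstance] =ᵐ[P] fun z => η z.1

/-- The `h`-hard margin condition. -/
def HardMargin {d : ℕ} (μ : Measure (E d)) (η : E d → ℝ) (h : ℝ) : Prop :=
  0 < h ∧ ∀ x ∈ μ.support, h ≤ |η x - 1 / 2|

/-- The part of the support of `μ` on which the Bayes classifier predicts `y`. -/
def classRegion {d : ℕ} (μ : Measure (E d)) (η : E d → ℝ) (y : Fin 2) : Set (E d) :=
  {x | x ∈ μ.support ∧ plugin η x = y}

/-- The class boundary: the common boundary of the two class regions. -/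
def classBoundary {d : ℕ} (μ : Measure (E d)) (η : E d → ℝ) : Set (E d) :=
  closure (classRegion μ η 0) ∩ closure (classRegion μ η 1)

/-- `η` is Lipschitz away from the class boundary, that is on each of the two parts `η < 1/2` and
`η > 1/2` of the support of `μ`; it may jump from one part to the other. -/
def LipschitzAwayFromBoundary {d : ℕ} (μ : Measure (E d)) (η : E d → ℝ) : Prop :=
  ∃ L : ℝ≥0, LipschitzOnWith L η {x | x ∈ μ.support ∧ η x < 1 / 2} ∧
    LipschitzOnWith L η {x | x ∈ μ.support ∧ 1 / 2 < η x}

/-- The `ε`-neighbourhoods of the class boundary have vanishing measure as `ε → 0`. -/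
def VanishingBoundary {d : ℕ} (μ : Measure (E d)) (η : E d → ℝ) : Prop :=
  Tendsto (fun ε : ℝ => μ (classBoundary μ η + Metric.closedBall 0 ε)) (𝓝[>] 0) (𝓝 0)

end SimplicialInterpolation

end

/-!
Away from a thin layer around `∂K` and the class boundary, the simplices of a Delaunay triangulation
of a fine net are small, so the Bayes classifier is constant on each of them. There the interpolant
errs at `p` only if `∑ i, w i * σ i ≥ 0`, where `w` are the barycentric coordinates of `p` and
`σ i = ±1` says whether the label of the `i`-th vertex disagrees with the Bayes classifier.
The barycentric coordinates of a uniform point of a simplex are normalized independent exponential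
variables, so by Chernoff's bound the volume fraction of these points is at most the product of the
factors `(1 - h * σ i)⁻¹`. Averaging over the labels, each of the `d + 1` vertices contributes a
factor at most `chernoffRate h < 1`. Nothing is misclassified unless some vertex carries a wrong
label; trading its factor for the probability of a wrong label bounds the excess risk by the Bayes
risk times `(1 - h)⁻¹ * chernoffRate h ^ d * (d + 1)`.
-/

noncomputable section

namespace SimplicialInterpolation

section Cone

variable {ι V : Type*} [Fintype ι] [NormedAddCommGroup V] [NormedSpace ℝ V]

/-- The cone over a set `A`, placed at height one in `V × ℝ`; the apex is not included. -/
def coneOver (A : Set V) : Set (V × ℝ) := {z | 0 < z.2 ∧ z.2⁻¹ • z.1 ∈ A}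

theorem integrableOn_Ici_exp_neg_mul {a : ℝ} (ha : 0 < a) :
    IntegrableOn (fun u => Real.exp (-(a * u))) (Ici 0) := by
  simpa only [neg_mul] using
    (integrableOn_Ici_iff_integrableOn_Ioi).2 (exp_neg_integrableOn_Ioi 0 ha)

theorem integral_Ici_exp_neg_mul {a : ℝ} (ha : 0 < a) :
    ∫ u in Ici (0 : ℝ), Real.exp (-(a * u)) = a⁻¹ := by
  rw [integral_Ici_eq_integral_Ioi]
  simpa [neg_mul, div_eq_mul_inv] using integral_exp_mul_Ioi (neg_lt_zero.2 ha) 0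

theorem lintegral_Ici_exp_neg_sum_mul {a : ι → ℝ} (ha : ∀ i, 0 < a i) :
    ∫⁻ u : ι → ℝ in Ici 0, ENNReal.ofReal (Real.exp (-∑ i, a i * u i)) =
      ∏ i, ENNReal.ofReal (a i)⁻¹ := by
  have hIci : (volume : Measure (ι → ℝ)).restrict (Ici 0) =
      Measure.pi fun _ => (volume : Measure ℝ).restrict (Ici 0) := by
    rw [← Set.pi_univ_Ici, volume_pi, Measure.restrict_pi_pi]
    rfl
  simp_rw [hIci, ← Finset.sum_neg_distrib, Real.exp_sum]
  rw [← ofReal_integral_eq_lintegral_ofReal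
      (Integrable.fintype_prod fun i => integrableOn_Ici_exp_neg_mul (ha i))
      (Eventually.of_forall fun u => Finset.prod_nonneg fun i _ => (Real.exp_pos _).le),
    integral_fintype_prod_eq_prod (fun i u => Real.exp (-(a i * u))),
    ← ENNReal.ofReal_prod_of_nonneg fun i _ => inv_nonneg.2 (ha i).le]
  simp_rw [integral_Ici_exp_neg_mul (ha _)]

variable [FiniteDimensional ℝ V]

/-- The linear bijection `u ↦ (∑ i, u i • b i, ∑ i, u i)` that turns barycentric coordinates with
respect to `b`, extended homogeneously, into points of the cone over `V`. -/
def homogenization (b : AffineBasis ι ℝ V) : (ι → ℝ) ≃L[ℝ] V × ℝ :=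
  (LinearEquiv.ofInjectiveOfFinrankEq
    ((Fintype.linearCombination ℝ (b : ι → V)).prod (Fintype.linearCombination ℝ fun _ => (1 : ℝ)))
    (by
      rw [injective_iff_map_eq_zero]
      intro u hu
      simp only [LinearMap.prod_apply, Function.prod_apply, Fintype.linearCombination_apply,
        Prod.mk_eq_zero, smul_eq_mul, mul_one] at hu
      ext i
      exact affineIndependent_iff.1 b.ind Finset.univ u hu.2 hu.1 i (Finset.mem_univ i))
    (by simp [b.card_eq_finrank_add_one])).toContinuousLinearEquiv

theorem homogenization_apply (b : AffineBasis ι ℝ V) (u : ι → ℝ) :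
    homogenization b u = (∑ i, u i • b i, ∑ i, u i) := by
  have h : homogenization b u = (Fintype.linearCombination ℝ (b : ι → V) u,
    Fintype.linearCombination ℝ (fun _ : ι => (1 : ℝ)) u) := rfl
  simp [h, Fintype.linearCombination_apply]

theorem homogenization_coords (b : AffineBasis ι ℝ V) (p : V) :
    homogenization b (b.coords p) = (p, 1) := by
  simp [homogenization_apply]

theorem coords_inv_sum_smul (b : AffineBasis ι ℝ V) {u : ι → ℝ} (hu : ∑ i, u i ≠ 0) :
    b.coords ((∑ i, u i)⁻¹ • ∑ i, u i • b i) = (∑ i, u i)⁻¹ • u := by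
  apply (homogenization b).injective
  rw [homogenization_coords, map_smul, homogenization_apply, Prod.smul_mk, smul_eq_mul,
    inv_mul_cancel₀ hu]

theorem homogenization_mem_coneOver_convexHull_iff (b : AffineBasis ι ℝ V) (u : ι → ℝ) :
    homogenization b u ∈ coneOver (convexHull ℝ (range b)) ↔ 0 < ∑ i, u i ∧ 0 ≤ u := by
  simp only [homogenization_apply, coneOver, mem_ofPred_eq]
  refine and_congr_right fun hu => ?_
  rw [b.convexHull_eq_nonneg_coord]
  change 0 ≤ b.coords _ ↔ _
  rw [coords_inv_sum_smul b hu.ne', smul_nonneg_iff_nonneg_of_pos_left (inv_pos.2 hu)]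

theorem homogenization_preimage_coneOver_convexHull_ae_eq (b : AffineBasis ι ℝ V) :
    homogenization b ⁻¹' coneOver (convexHull ℝ (range b)) =ᵐ[volume] Ici (0 : ι → ℝ) := by
  have := b.nonempty
  filter_upwards [compl_mem_ae_iff.2 (measure_singleton (0 : ι → ℝ))] with u hu
  refine propext ((homogenization_mem_coneOver_convexHull_iff b u).trans
    (and_iff_right_of_imp fun h0 => ?_))
  exact Fintype.sum_pos (lt_of_le_of_ne h0 (Ne.symm hu))

variable [MeasurableSpace V] [BorelSpace V] (μ : Measure V) [μ.IsAddHaarMeasure]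

theorem measurableSet_coneOver {A : Set V} (hA : MeasurableSet A) :
    MeasurableSet (coneOver A) :=
  (measurableSet_lt measurable_const measurable_snd).inter
    ((measurable_snd.inv.smul measurable_fst) hA)

theorem lintegral_coneOver {A : Set V} (hA : MeasurableSet A) {g : ℝ → ℝ≥0∞} (hg : Measurable g) :
    ∫⁻ z in coneOver A, g z.2 ∂(μ.prod volume) =
      (∫⁻ τ in Ioi 0, g τ * ENNReal.ofReal (τ ^ Module.finrank ℝ V)) * μ A := by
  have hslice : ∀ τ : ℝ, ∫⁻ p, (coneOver A).indicator (fun z => g z.2) (p, τ) ∂μ =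
      (Ioi 0).indicator (fun τ => g τ * ENNReal.ofReal (τ ^ Module.finrank ℝ V) * μ A) τ := by
    intro τ
    by_cases hτ : 0 < τ
    · have hsection : (fun p => (p, τ)) ⁻¹' coneOver A = τ • A := by
        ext p
        simp [coneOver, hτ, mem_smul_set_iff_inv_smul_mem₀ hτ.ne']
      change ∫⁻ p, ((fun p => (p, τ)) ⁻¹' coneOver A).indicator (fun _ => g τ) p ∂μ = _
      rw [hsection, lintegral_indicator_const (hA.const_smul₀ τ), Measure.addHaar_smul,
        indicator_of_mem (mem_Ioi.2 hτ), mul_assoc, abs_of_nonneg (pow_nonneg hτ.le _)]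
    · rw [indicator_of_notMem (by simpa using hτ)]
      simp [coneOver, indicator, hτ]
  have hmeas : Measurable ((coneOver A).indicator fun z => g z.2) :=
    (hg.comp measurable_snd).indicator (measurableSet_coneOver hA)
  rw [← lintegral_indicator (measurableSet_coneOver hA), lintegral_prod_symm _ hmeas.aemeasurable]
  simp_rw [hslice]
  rw [lintegral_indicator measurableSet_Ioi, lintegral_mul_const _ (by fun_prop)]

theorem exists_lintegral_homogenization_preimage_coneOver (b : AffineBasis ι ℝ V) :
    ∃ k : ℝ≥0∞, ∀ A : Set V, MeasurableSet A →
      ∫⁻ u in homogenization b ⁻¹' coneOver A, ENNReal.ofReal (Real.exp (-∑ i, u i)) =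
        k * μ A := by
  let Ψ := homogenization b
  have : ((volume : Measure (ι → ℝ)).map Ψ).IsAddHaarMeasure := Ψ.isAddHaarMeasure_map volume
  let c := ((volume : Measure (ι → ℝ)).map Ψ).addHaarScalarFactor (μ.prod volume)
  have hmap : (volume : Measure (ι → ℝ)).map Ψ = c • (μ.prod volume) :=
    Measure.isAddLeftInvariant_eq_smul _ _
  refine ⟨c * ∫⁻ τ in Ioi 0, ENNReal.ofReal (Real.exp (-τ)) *
    ENNReal.ofReal (τ ^ Module.finrank ℝ V), fun A hA => ?_⟩
  calc ∫⁻ u in Ψ ⁻¹' coneOver A, ENNReal.ofReal (Real.exp (-∑ i, u i))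
      = ∫⁻ u in Ψ ⁻¹' coneOver A, ENNReal.ofReal (Real.exp (-(Ψ u).2)) := by
        simp only [Ψ, homogenization_apply]
    _ = ∫⁻ z in coneOver A, ENNReal.ofReal (Real.exp (-z.2)) ∂volume.map Ψ :=
        (setLIntegral_map (f := fun z : V × ℝ => ENNReal.ofReal (Real.exp (-z.2)))
          (measurableSet_coneOver hA) (by fun_prop)
          Ψ.continuous.measurable).symm
    _ = c * ∫⁻ z in coneOver A, ENNReal.ofReal (Real.exp (-z.2)) ∂(μ.prod volume) := by
        rw [hmap, Measure.restrict_smul, lintegral_smul_measure]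
        rfl
    _ = _ := by
        rw [lintegral_coneOver μ hA (g := fun τ => ENNReal.ofReal (Real.exp (-τ))) (by fun_prop),
          mul_assoc]

theorem measure_convexHull_inter_halfspace_le (b : AffineBasis ι ℝ V) (a : ι → ℝ) {t : ℝ}
    (ht : 0 ≤ t) (hta : ∀ i, 0 < 1 - t * a i) :
    μ {p ∈ convexHull ℝ (range b) | 0 ≤ ∑ i, b.coord i p * a i} ≤
      (∏ i, ENNReal.ofReal (1 - t * a i)⁻¹) * μ (convexHull ℝ (range b)) := by
  obtain ⟨k, hk⟩ := exists_lintegral_homogenization_preimage_coneOver μ b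
  set S := convexHull ℝ (range b)
  set A := {p ∈ S | 0 ≤ ∑ i, b.coord i p * a i}
  have hS : MeasurableSet S := ((finite_range b).isCompact_convexHull ℝ).measurableSet
  have hA : MeasurableSet A := hS.inter
    (measurableSet_le measurable_const (Finset.measurable_fun_sum _ fun i _ =>
      (continuous_barycentric_coord b i).measurable.mul_const (a i)))
  have hconeA : ∀ u ∈ homogenization b ⁻¹' coneOver A, 0 ≤ u ∧ 0 ≤ ∑ i, u i * a i := by
    intro u hu
    obtain ⟨hpos, hu0⟩ :=
      (homogenization_mem_coneOver_convexHull_iff b u).1 ⟨hu.1, hu.2.1⟩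
    refine ⟨hu0, ?_⟩
    have hhalf := hu.2.2
    simp only [homogenization_apply] at hhalf
    simp only [← b.coords_apply, coords_inv_sum_smul b hpos.ne', Pi.smul_apply, smul_eq_mul,
      mul_assoc, ← Finset.mul_sum] at hhalf
    exact (mul_nonneg_iff_of_pos_left (inv_pos.2 hpos)).1 hhalf
  have hkS : k * μ S = 1 := by
    rw [← hk S hS, setLIntegral_congr (homogenization_preimage_coneOver_convexHull_ae_eq b)]
    simpa using lintegral_Ici_exp_neg_sum_mul (ι := ι) (a := 1) fun _ => one_pos
  have hkA : k * μ A ≤ ∏ i, ENNReal.ofReal (1 - t * a i)⁻¹ := by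
    rw [← hk A hA, ← lintegral_Ici_exp_neg_sum_mul hta]
    refine (setLIntegral_mono (by fun_prop) fun u hu => ?_).trans
      (lintegral_mono_set fun u hu => (hconeA u hu).1)
    refine ENNReal.ofReal_le_ofReal (Real.exp_le_exp.2 (neg_le_neg ?_))
    calc ∑ i, (1 - t * a i) * u i = ∑ i, u i - t * ∑ i, u i * a i := by
          rw [Finset.mul_sum, ← Finset.sum_sub_distrib]
          exact Finset.sum_congr rfl fun i _ => by ring
      _ ≤ ∑ i, u i := sub_le_self _ (mul_nonneg ht (hconeA u hu).2)
  calc μ A = k * μ A * μ S := by rw [mul_right_comm, hkS, one_mul]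
    _ ≤ _ := by gcongr

end Cone

/-! ### Dense configurations -/

section DenseConfigurations

variable {ι : Type*}

theorem radius_lt_of_closedBall_subset_iUnion_ball {V : Type*} [NormedAddCommGroup V]
    [NormedSpace ℝ V] {x : ι → V} {p c : V} {r R : ℝ} (hr : 0 ≤ r)
    (hx : Metric.closedBall p r ⊆ ⋃ i, Metric.ball (x i) r) (hpc : dist p c ≤ R)
    (hempty : ∀ i, R ≤ dist c (x i)) : R < r := by
  by_contra! hR
  obtain ⟨q, hpq, hqc⟩ : ∃ q, dist p q ≤ r ∧ dist q c ≤ R - r :=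
    exists_dist_le_le hr (sub_nonneg.2 hR) (by simpa using hpc)
  obtain ⟨i, hi⟩ := mem_iUnion.1 (hx (Metric.mem_closedBall'.2 hpq))
  have := dist_triangle_left c (x i) q
  have := hempty i
  have := Metric.mem_ball.1 hi
  linarith

variable [Finite ι] {V : Type*} [NormedAddCommGroup V] [InnerProductSpace ℝ V] {x : ι → V} {p : V}
  {r : ℝ}

theorem mem_convexHull_of_closedBall_subset_iUnion_ball (hr : 0 ≤ r)
    (hx : Metric.closedBall p r ⊆ ⋃ i, Metric.ball (x i) r) : p ∈ convexHull ℝ (range x) := by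
  have hnonempty : (convexHull ℝ (range x)).Nonempty := by
    obtain ⟨i, -⟩ := mem_iUnion.1 (hx (Metric.mem_closedBall_self hr))
    exact ⟨x i, subset_convexHull ℝ _ (mem_range_self i)⟩
  obtain ⟨v, hv, hmin⟩ := exists_norm_eq_iInf_of_complete_convex hnonempty
    ((finite_range x).isCompact_convexHull ℝ).isComplete (convex_convexHull ℝ _) p
  have hnormal := (norm_eq_iInf_iff_real_inner_le_zero (convex_convexHull ℝ _) hv).1 hmin
  by_contra hp
  have hu : 0 < ‖p - v‖ := norm_pos_iff.2 (sub_ne_zero.2 fun h => hp (h ▸ hv))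
  set u := p - v
  have hq : p + (r / ‖u‖) • u ∈ Metric.closedBall p r := by
    rw [mem_closedBall_iff_norm, add_sub_cancel_left, norm_smul,
      Real.norm_of_nonneg (by positivity), div_mul_cancel₀ _ hu.ne']
  obtain ⟨i, hi⟩ := mem_iUnion.1 (hx hq)
  have hinner : inner ℝ u (p + (r / ‖u‖) • u - x i) =
      ‖u‖ ^ 2 + r * ‖u‖ - inner ℝ u (x i - v) := by
    rw [show p + (r / ‖u‖) • u - x i = u + (r / ‖u‖) • u - (x i - v) by simp only [u]; abel,
      inner_sub_right, inner_add_right, inner_smul_right, real_inner_self_eq_norm_sq]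
    field_simp
  have hle := hnormal (x i) (subset_convexHull ℝ _ (mem_range_self i))
  have hcs := real_inner_le_norm u (p + (r / ‖u‖) • u - x i)
  have hlt : ‖u‖ * ‖p + (r / ‖u‖) • u - x i‖ < ‖u‖ * r := by
    gcongr
    exact mem_ball_iff_norm.1 hi
  nlinarith

theorem affineSpan_eq_top_of_closedBall_subset_iUnion_ball (hr : 0 < r)
    (hx : Metric.closedBall p (2 * r) ⊆ ⋃ i, Metric.ball (x i) r) :
    affineSpan ℝ (range x) = ⊤ := by
  refine affineSpan_eq_top_of_nonempty_interior ⟨p, mem_interior_iff_mem_nhds.2 ?_⟩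
  refine mem_of_superset (Metric.ball_mem_nhds p hr) fun q hq => ?_
  refine mem_convexHull_of_closedBall_subset_iUnion_ball hr.le (subset_trans ?_ hx)
  exact Metric.closedBall_subset_closedBall' (by linarith [Metric.mem_ball.1 hq])

end DenseConfigurations

/-! ### Simplices of a Delaunay triangulation -/

section Simplices

variable {d n : ℕ} {x : Fin n → E d} {T : Set (Finset (Fin n))} {s : Finset (Fin n)}

theorem IsDelaunayTriangulation.dist_le (hT : IsDelaunayTriangulation x T) {r : ℝ} (hr : 0 ≤ r)
    (hs : s ∈ T) {p : E d} (hx : Metric.closedBall p r ⊆ ⋃ i, Metric.ball (x i) r)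
    (hp : p ∈ convexHull ℝ (x '' s)) {q q' : E d} (hq : q ∈ convexHull ℝ (x '' s))
    (hq' : q' ∈ convexHull ℝ (x '' s)) : dist q q' ≤ 2 * r := by
  obtain ⟨c, hc⟩ := hT.delaunay s hs
  obtain ⟨i₀, hi₀⟩ : s.Nonempty := by
    rw [← Finset.card_pos, hT.card_eq s hs]
    exact d.succ_pos
  have hball : convexHull ℝ (x '' s) ⊆ Metric.closedBall c (dist c (x i₀)) := by
    refine convexHull_min ?_ (convex_closedBall _ _)
    rintro _ ⟨i, hi, rfl⟩
    exact Metric.mem_closedBall'.2 (hc i hi i₀)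
  have hradius := radius_lt_of_closedBall_subset_iUnion_ball hr hx (hball hp) (hc i₀ hi₀)
  calc dist q q' ≤ dist q c + dist q' c := dist_triangle_right q q' c
    _ ≤ 2 * r := by
        linarith [Metric.mem_closedBall.1 (hball hq), Metric.mem_closedBall.1 (hball hq')]

theorem IsDelaunayTriangulation.exists_affineBasis (hT : IsDelaunayTriangulation x T)
    (hs : s ∈ T) : ∃ b : AffineBasis s ℝ (E d), ∀ i, b i = x i := by
  have hspan := (hT.nondegenerate s hs).affineSpan_eq_top_iff_card_eq_finrank_add_one.2
    (by simp [hT.card_eq s hs])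
  exact ⟨⟨fun i => x i, hT.nondegenerate s hs, hspan⟩, fun _ => rfl⟩

theorem IsDelaunayTriangulation.volume_inter_eq_zero (hT : IsDelaunayTriangulation x T)
    {t : Finset (Fin n)} (hs : s ∈ T) (ht : t ∈ T) (hst : s ≠ t) :
    volume (convexHull ℝ (x '' s) ∩ convexHull ℝ (x '' t)) = 0 := by
  classical
  rw [hT.inter s hs t ht, ← Finset.coe_inter, image_eq_range]
  refine measure_mono_null (convexHull_subset_affineSpan _)
    (Measure.addHaar_affineSubspace volume _ fun htop => hst ?_)
  have hind : AffineIndependent ℝ fun i : ↥(s ∩ t) => x i :=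
    (hT.nondegenerate s hs).comp_embedding
      (Subtype.impEmbedding _ _ fun _ hi => Finset.mem_of_mem_inter_left hi)
  have hcard : (s ∩ t).card = d + 1 := by
    rw [← Fintype.card_coe, hind.affineSpan_eq_top_iff_card_eq_finrank_add_one.1 htop,
      finrank_euclideanSpace_fin]
  have hinter_s := Finset.eq_of_subset_of_card_le (Finset.inter_subset_left (s₁ := s) (s₂ := t))
    (by rw [hT.card_eq s hs, hcard])
  have hinter_t := Finset.eq_of_subset_of_card_le (Finset.inter_subset_right (s₁ := s) (s₂ := t))
    (by rw [hT.card_eq t ht, hcard])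
  exact hinter_s.symm.trans hinter_t

theorem exists_add_inner_eq {V : Type*} [NormedAddCommGroup V] [InnerProductSpace ℝ V]
    [FiniteDimensional ℝ V] (f : V →ᵃ[ℝ] ℝ) : ∃ c : ℝ × V, ∀ p, c.1 + inner ℝ p c.2 = f p := by
  refine ⟨(f 0, (InnerProductSpace.toDual ℝ V).symm (f.linear.toContinuousLinearMap)), fun p => ?_⟩
  rw [real_inner_comm, InnerProductSpace.toDual_symm_apply, LinearMap.coe_toContinuousLinearMap',
    add_comm]
  exact (congrFun f.decomp p).symm

theorem linearInterpolation_eq_sum_coord (b : AffineBasis s ℝ (E d)) (hb : ∀ i, b i = x i)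
    (y : Fin n → ℝ) (p : E d) :
    linearInterpolation x y s p = ∑ i, b.coord i p * y i := by
  have hexists : ∃ c : ℝ × E d, ∀ i ∈ s, c.1 + inner ℝ (x i) c.2 = y i := by
    obtain ⟨c, hc⟩ := exists_add_inner_eq
      ((Fintype.linearCombination ℝ fun i : s => y i).toAffineMap.comp b.coords)
    refine ⟨c, fun i hi => ?_⟩
    classical
    rw [hc, ← hb ⟨i, hi⟩]
    simp [Fintype.linearCombination_apply, AffineBasis.coord_apply]
  rw [linearInterpolation, dif_pos hexists]
  have hspec := hexists.choose_spec
  set c := hexists.choose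
  calc c.1 + inner ℝ p c.2
      = (∑ i, b.coord i p) * c.1 + inner ℝ (∑ i, b.coord i p • b i) c.2 := by
        rw [b.sum_coord_apply_eq_one, b.linear_combination_coord_eq_self, one_mul]
    _ = ∑ i, b.coord i p * (c.1 + inner ℝ (x i) c.2) := by
        simp only [Finset.sum_mul, sum_inner, ← Finset.sum_add_distrib, real_inner_smul_left,
          mul_add, hb]
    _ = ∑ i, b.coord i p * y i := by
        exact Finset.sum_congr rfl fun i _ => by rw [hspec i i.2]

end Simplices

/-! ### The class boundary -/

section ClassBoundary

variable {d : ℕ} {μ : Measure (E d)} {η : E d → ℝ}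

theorem exists_mem_segment_classBoundary (hconv : Convex ℝ μ.support) {p q : E d}
    (hp : p ∈ μ.support) (hq : q ∈ μ.support) (hne : plugin η p ≠ plugin η q) :
    (segment ℝ p q ∩ classBoundary μ η).Nonempty := by
  have hmem : ∀ z ∈ segment ℝ p q, z ∈ closure (classRegion μ η (plugin η z)) := fun z hz =>
    subset_closure ⟨hconv.segment_subset hp hq hz, rfl⟩
  have hmeets : ∀ y, (segment ℝ p q ∩ closure (classRegion μ η y)).Nonempty := by
    intro y
    obtain h | h : plugin η p = y ∨ plugin η q = y := by omega
    · exact ⟨p, left_mem_segment ℝ p q, h ▸ hmem p (left_mem_segment ℝ p q)⟩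
    · exact ⟨q, right_mem_segment ℝ p q, h ▸ hmem q (right_mem_segment ℝ p q)⟩
  refine isPreconnected_closed_iff.1 (convex_segment p q).isPreconnected _ _ isClosed_closure
    isClosed_closure (fun z hz => ?_) (hmeets 0) (hmeets 1)
  obtain h | h : plugin η z = 0 ∨ plugin η z = 1 := by omega
  · exact Or.inl (h ▸ hmem z hz)
  · exact Or.inr (h ▸ hmem z hz)

theorem plugin_eq_of_notMem_cthickening (hconv : Convex ℝ μ.support) {p q : E d}
    (hp : p ∈ μ.support) (hq : q ∈ μ.support) {δ : ℝ} (hpq : dist p q ≤ δ)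
    (hfar : p ∉ Metric.cthickening δ (classBoundary μ η)) : plugin η q = plugin η p := by
  by_contra hne
  obtain ⟨z, hz, hzb⟩ := exists_mem_segment_classBoundary hconv hp hq (Ne.symm hne)
  refine hfar (Metric.mem_cthickening_of_dist_le p z δ _ hzb ?_)
  exact (mem_closedBall_iff_norm'.1 (segment_subset_closedBall_left p q hz)).trans
    (dist_eq_norm p q ▸ hpq)

end ClassBoundary

/-! ### Random labels -/

section RandomLabels

theorem lintegral_pi_compProd_le {ι α β : Type*} [Fintype ι] [MeasurableSpace α]
    [MeasurableSpace β] [StandardBorelSpace β] [Nonempty β] (μ : Measure α) [IsFiniteMeasure μ]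
    (κ : Kernel α β) [IsMarkovKernel κ] {F : (ι → α × β) → ℝ≥0∞}
    (hF : ∀ x : ι → α, Measurable fun y : ι → β => F fun i => (x i, y i)) :
    ∫⁻ z, F z ∂Measure.pi (fun _ : ι => μ ⊗ₘ κ) ≤
      ∫⁻ x, ∫⁻ y, F (fun i => (x i, y i)) ∂Measure.pi (fun i => κ (x i))
        ∂Measure.pi fun _ : ι => μ := by
  -- With independent uniform variables `u i`, the labels can be taken to be `g (x i) (u i)`.
  obtain ⟨g, hg, hgκ⟩ := κ.exists_measurable_map_eq_unitInterval
  have hlabel : Measurable fun w : α × unitInterval => (w.1, g w.1 w.2) :=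
    measurable_fst.prodMk hg
  have hjoint : μ ⊗ₘ κ = (μ.prod volume).map fun w => (w.1, g w.1 w.2) := by
    ext S hS
    rw [Measure.compProd_apply hS, Measure.map_apply hlabel hS, Measure.prod_apply (hlabel hS)]
    refine lintegral_congr fun p => ?_
    rw [← hgκ p, Measure.map_apply (hg.of_uncurry_left) (measurable_prodMk_left hS)]
    rfl
  have hsplit := measurePreserving_arrowProdEquivProdArrow α unitInterval ι (fun _ => μ)
    fun _ => volume
  calc ∫⁻ z, F z ∂Measure.pi (fun _ : ι => μ ⊗ₘ κ)
      ≤ ∫⁻ w, F (fun i => ((w i).1, g (w i).1 (w i).2))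
          ∂Measure.pi fun _ : ι => μ.prod (volume : Measure unitInterval) := by
        rw [hjoint, ← Measure.pi_map_pi fun _ => hlabel.aemeasurable]
        exact lintegral_map_le _ _
    _ = ∫⁻ w, F (fun i => (w.1 i, g (w.1 i) (w.2 i)))
          ∂(Measure.pi fun _ : ι => μ).prod (Measure.pi fun _ => volume) := by
        rw [← hsplit.map_eq, lintegral_map_equiv]
        rfl
    _ ≤ ∫⁻ x, ∫⁻ u, F (fun i => (x i, g (x i) (u i))) ∂(Measure.pi fun _ => volume)
          ∂Measure.pi fun _ : ι => μ := lintegral_prod_le _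
    _ = _ := by
        refine lintegral_congr fun x => ?_
        have hmeas : Measurable fun (u : ι → unitInterval) i => g (x i) (u i) :=
          measurable_pi_lambda _ fun i => hg.of_uncurry_left.comp (measurable_pi_apply i)
        simp only [← hgκ]
        rw [← Measure.pi_map_pi fun i => hg.of_uncurry_left.aemeasurable,
          lintegral_map (hF x) hmeas]

theorem lintegral_pi_finsetProd {ι : Type*} [Fintype ι] {β : ι → Type*} [∀ i, MeasurableSpace (β i)]
    (ν : ∀ i, Measure (β i)) [∀ i, IsProbabilityMeasure (ν i)] (s : Finset ι)
    {f : ∀ i, β i → ℝ≥0∞} (hf : ∀ i, Measurable (f i)) :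
    ∫⁻ y, ∏ i ∈ s, f i (y i) ∂Measure.pi ν = ∏ i ∈ s, ∫⁻ y, f i y ∂ν i := by
  have hind : iIndepFun (fun i (y : ∀ i, β i) => f i (y i)) (Measure.pi ν) :=
    iIndepFun_pi fun i => (hf i).aemeasurable
  rw [lintegral_prod_eq_prod_lintegral_of_indepFun s _ hind fun i =>
    (hf i).comp (measurable_pi_apply i)]
  exact Finset.prod_congr rfl fun i _ => (measurePreserving_eval ν i).lintegral_comp (hf i)

variable {d : ℕ} {P : Measure (E d × Fin 2)} {η : E d → ℝ}

theorem IsConditionalMean.condKernel_real_singleton_one [IsFiniteMeasure P]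
    (hη : IsConditionalMean P η) : ∀ᵐ p ∂P.fst, (P.condKernel p).real {1} = η p := by
  have hlabel : (fun z : E d × Fin 2 => label z.2) =
      (Prod.snd ⁻¹' {1}).indicator fun _ => (1 : ℝ) := by
    ext ⟨p, y⟩
    fin_cases y <;> simp [label]
  have hdistrib := condDistrib_ae_eq_condExp (μ := P) measurable_fst measurable_snd
    (measurableSet_singleton (1 : Fin 2))
  simp only [condDistrib, Prod.mk.eta, Measure.map_id', ← hlabel] at hdistrib
  refine (ae_map_iff measurable_fst.aemeasurable ?_).2 (hdistrib.trans hη.2)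
  exact measurableSet_eq_fun
    (Kernel.measurable_coe _ (measurableSet_singleton _)).ennreal_toReal hη.1

/-- The probability that the Bayes classifier errs at `p` when the label is one with probability
`η p`. -/
def bayesError (η : E d → ℝ) (p : E d) : ℝ≥0∞ := ENNReal.ofReal (min (η p) (1 - η p))

theorem bayesError_le_add {p q : E d} {ε : ℝ} (hpq : |η p - η q| ≤ ε) :
    bayesError η p ≤ bayesError η q + ENNReal.ofReal ε := by
  refine (ENNReal.ofReal_le_ofReal ?_).trans ENNReal.ofReal_add_le
  rw [← min_add_add_right]
  obtain ⟨hlower, hupper⟩ := abs_le.1 hpq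
  exact min_le_min (by linarith) (by linarith)

theorem bayesError_le_one (η : E d → ℝ) (p : E d) : bayesError η p ≤ 1 := by
  rw [bayesError, ENNReal.ofReal_le_one]
  rcases le_total (η p) 1 with h | h
  · exact (min_le_left _ _).trans h
  · exact (min_le_right _ _).trans (by linarith)

theorem HardMargin.bayesError_le {μ : Measure (E d)} {h : ℝ} (hm : HardMargin μ η h) {p : E d}
    (hp : p ∈ μ.support) : bayesError η p ≤ ENNReal.ofReal (1 / 2 - h) := by
  refine ENNReal.ofReal_le_ofReal ?_
  rcases le_abs'.1 (hm.2 p hp) with hlow | hhigh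
  · exact (min_le_left _ _).trans (by linarith)
  · exact (min_le_right _ _).trans (by linarith)

theorem measure_singleton_rev_plugin {ν : Measure (Fin 2)} [IsProbabilityMeasure ν] {p : E d}
    (hν : ν.real {1} = η p) : ν {(plugin η p).rev} = bayesError η p := by
  have hzero : ν.real {0} = 1 - η p := by
    rw [← hν, ← probReal_compl_eq_one_sub (measurableSet_singleton _)]
    exact congrArg ν.real (by ext y; fin_cases y <;> simp)
  rw [bayesError, ← ofReal_measureReal, plugin]
  split_ifs with hp
  · rw [show (1 : Fin 2).rev = 0 from rfl, hzero, min_eq_right (by linarith)]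
  · rw [show (0 : Fin 2).rev = 1 from rfl, hν, min_eq_left (by linarith)]

theorem IsConditionalMean.measurable_plugin (hη : IsConditionalMean P η) : Measurable (plugin η) :=
  Measurable.ite (measurableSet_lt measurable_const hη.1) measurable_const measurable_const

theorem IsConditionalMean.risk_plugin [IsFiniteMeasure P] (hη : IsConditionalMean P η) :
    risk P (plugin η) = ∫⁻ p, bayesError η p ∂P.fst := by
  have hmeas : MeasurableSet {z : E d × Fin 2 | plugin η z.1 ≠ z.2} :=
    (measurableSet_eq_fun (hη.measurable_plugin.comp measurable_fst) measurable_snd).compl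
  rw [risk]
  nth_rw 1 [← P.disintegrate P.condKernel]
  rw [Measure.compProd_apply hmeas]
  refine lintegral_congr_ae ?_
  filter_upwards [hη.condKernel_real_singleton_one] with p hp
  rw [← measure_singleton_rev_plugin hp]
  congr 1
  ext y
  simp only [mem_preimage, mem_ofPred_eq, mem_singleton_iff]
  grind [Fin.rev]

theorem risk_le_risk_add {f g : E d → Fin 2} :
    risk P f ≤ risk P g + P.fst {p | f p ≠ g p} := by
  have hsub : {z : E d × Fin 2 | f z.1 ≠ z.2} ⊆
      {z | g z.1 ≠ z.2} ∪ Prod.fst ⁻¹' {p | f p ≠ g p} := by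
    intro z hz
    by_cases hfg : f z.1 = g z.1
    · exact Or.inl fun h => hz (hfg.trans h)
    · exact Or.inr hfg
  exact (measure_mono hsub).trans ((measure_union_le _ _).trans
    (add_le_add_right (Measure.le_map_apply measurable_fst.aemeasurable _) _))

end RandomLabels

/-! ### The Chernoff bound for random labels -/

section LabelChernoff

/-- The moment generating function at `t < 1` of a standard exponential variable if `y = e`, and of
its negative otherwise. -/
def labelMgf (t : ℝ) (e y : Fin 2) : ℝ≥0∞ := ENNReal.ofReal (1 - t * if y = e then 1 else -1)⁻¹

/-- A bound, under the `h`-hard margin condition, for the average of `labelMgf h e` over a label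
that errs if it equals `e`. -/
def chernoffRate (h : ℝ) : ℝ := (1 - 2 * h ^ 2) / (1 - h ^ 2)

theorem sum_mul_sign_nonneg_of_plugin_eq {d : ℕ} {ι : Type*} [Fintype ι] {w : ι → ℝ}
    (hw : ∑ i, w i = 1) {y : ι → Fin 2} {e : Fin 2} {g : E d → ℝ} {p : E d}
    (hg : g p = ∑ i, w i * label (y i)) (he : plugin g p = e) :
    0 ≤ ∑ i, w i * if y i = e then (1 : ℝ) else -1 := by
  have hsign : ∀ y : Fin 2, (if y = e then (1 : ℝ) else -1) =
      (label e - 1 / 2) * (4 * label y - 2) := by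
    intro y
    fin_cases y <;> fin_cases e <;> norm_num [label]
  have hmargin : 0 ≤ (label e - 1 / 2) * (g p - 1 / 2) := by
    rw [← he, plugin]
    split_ifs with h
    · norm_num [label]
      linarith
    · norm_num [label]
      linarith
  calc (0 : ℝ) ≤ 4 * ((label e - 1 / 2) * (g p - 1 / 2)) := by linarith
    _ = (label e - 1 / 2) * (4 * ∑ i, w i * label (y i) - 2 * ∑ i, w i) := by rw [hg, hw]; ring
    _ = ∑ i, w i * if y i = e then (1 : ℝ) else -1 := by
      simp only [hsign, Finset.mul_sum, ← Finset.sum_sub_distrib]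
      exact Finset.sum_congr rfl fun i _ => by ring

theorem volume_plugin_linearInterpolation_eq_le {d n : ℕ} {x : Fin n → E d} {s : Finset (Fin n)}
    (b : AffineBasis s ℝ (E d)) (hb : ∀ i, b i = x i) (y : Fin n → Fin 2) (e : Fin 2) {t : ℝ}
    (ht : 0 ≤ t) (ht' : t < 1) :
    volume {p ∈ convexHull ℝ (x '' s) |
        plugin (linearInterpolation x (fun i => label (y i)) s) p = e} ≤
      (∑ j ∈ s, (if y j = e then 1 else 0) * ∏ i ∈ s, labelMgf t e (y i)) *
        volume (convexHull ℝ (x '' s)) := by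
  have hrange : x '' s = range b := by rw [image_eq_range, funext hb]; rfl
  have hsum : ∀ p ∈ {p ∈ convexHull ℝ (x '' s) |
      plugin (linearInterpolation x (fun i => label (y i)) s) p = e},
      0 ≤ ∑ i, b.coord i p * if y i = e then (1 : ℝ) else -1 := fun p hp =>
    sum_mul_sign_nonneg_of_plugin_eq (b.sum_coord_apply_eq_one p)
      (linearInterpolation_eq_sum_coord b hb _ p) hp.2
  by_cases he : ∃ j ∈ s, y j = e
  · obtain ⟨j, hj, hje⟩ := he
    calc _ ≤ volume {p ∈ convexHull ℝ (range b) |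
            0 ≤ ∑ i, b.coord i p * if y i = e then (1 : ℝ) else -1} :=
          measure_mono fun p hp => ⟨hrange ▸ hp.1, hsum p hp⟩
      _ ≤ (∏ i : s, labelMgf t e (y i)) * volume (convexHull ℝ (range b)) :=
          measure_convexHull_inter_halfspace_le volume b _ ht fun i => by split_ifs <;> linarith
      _ ≤ _ := by
          rw [← hrange, s.prod_coe_sort fun i => labelMgf t e (y i), ← Finset.sum_mul]
          gcongr
          refine le_mul_of_one_le_left' ?_
          exact (if_pos hje).ge.trans (Finset.single_le_sum
            (f := fun j => if y j = e then (1 : ℝ≥0∞) else 0) (fun _ _ => zero_le) hj)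
  · push Not at he
    refine (measure_mono_null (t := ∅) (fun p hp => ?_) measure_empty).trans_le zero_le
    have := hsum p hp
    simp only [he _ (Finset.coe_mem _), if_false, mul_neg, mul_one, Finset.sum_neg_distrib,
      b.sum_coord_apply_eq_one] at this
    linarith

theorem lintegral_labelMgf_le {ν : Measure (Fin 2)} [IsProbabilityMeasure ν] {e : Fin 2} {h : ℝ}
    (h0 : 0 ≤ h) (hh : h ≤ 1 / 2) (hν : ν {e} ≤ ENNReal.ofReal (1 / 2 - h)) :
    ∫⁻ y, labelMgf h e y ∂ν ≤ ENNReal.ofReal (chernoffRate h) := by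
  have hrev : ν.real {e.rev} = 1 - ν.real {e} := by
    rw [← probReal_compl_eq_one_sub (measurableSet_singleton _)]
    exact congrArg ν.real (by ext y; fin_cases y <;> fin_cases e <;> simp)
  have herr : ν.real {e} ≤ 1 / 2 - h := ENNReal.toReal_le_of_le_ofReal (by linarith) hν
  have hsub : 0 < 1 - h := by linarith
  have hsplit : ∫⁻ y, labelMgf h e y ∂ν =
      ENNReal.ofReal ((1 - h)⁻¹ * ν.real {e} + (1 + h)⁻¹ * ν.real {e.rev}) := by
    rw [ENNReal.ofReal_add (by positivity) (by positivity), ENNReal.ofReal_mul (by positivity),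
      ENNReal.ofReal_mul (by positivity), ofReal_measureReal, ofReal_measureReal, lintegral_fintype,
      Fin.sum_univ_two]
    fin_cases e <;> simp [labelMgf, add_comm]
  rw [hsplit, hrev, chernoffRate]
  refine ENNReal.ofReal_le_ofReal ?_
  calc (1 - h)⁻¹ * ν.real {e} + (1 + h)⁻¹ * (1 - ν.real {e})
      = (1 - h * (1 - 2 * ν.real {e})) / (1 - h ^ 2) := by
        rw [show 1 - h ^ 2 = (1 - h) * (1 + h) by ring]
        field_simp
        ring
    _ ≤ (1 - 2 * h ^ 2) / (1 - h ^ 2) := by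
        exact div_le_div_of_nonneg_right (by nlinarith) (by nlinarith)

theorem lintegral_sum_prod_labelMgf_le {ι : Type*} [Fintype ι] {ν : ι → Measure (Fin 2)}
    [∀ i, IsProbabilityMeasure (ν i)] {e : Fin 2} {h : ℝ} (h0 : 0 ≤ h) (hh : h ≤ 1 / 2)
    (s : Finset ι) (hν : ∀ i ∈ s, ν i {e} ≤ ENNReal.ofReal (1 / 2 - h)) :
    ∫⁻ y, ∑ j ∈ s, (if y j = e then 1 else 0) * ∏ i ∈ s, labelMgf h e (y i) ∂Measure.pi ν ≤
      ENNReal.ofReal ((1 - h)⁻¹ * chernoffRate h ^ (s.card - 1)) * ∑ j ∈ s, ν j {e} := by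
  classical
  rw [lintegral_finsetSum _ fun _ _ => Measurable.of_discrete, Finset.mul_sum]
  refine Finset.sum_le_sum fun j hj => ?_
  let f : ι → Fin 2 → ℝ≥0∞ := fun i b =>
    (if i = j then if b = e then 1 else 0 else 1) * labelMgf h e b
  have hf : ∀ y : ι → Fin 2, (if y j = e then 1 else 0) * ∏ i ∈ s, labelMgf h e (y i) =
      ∏ i ∈ s, f i (y i) := by
    intro y
    simp only [f, Finset.prod_mul_distrib]
    rw [Finset.prod_ite_eq' s j fun i => if y i = e then (1 : ℝ≥0∞) else 0, if_pos hj]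
  have hfj : ∫⁻ b, f j b ∂ν j = ENNReal.ofReal (1 - h)⁻¹ * ν j {e} := by
    rw [lintegral_fintype, Finset.sum_eq_single e (fun b _ hb => by simp [f, hb]) (by simp)]
    simp [f, labelMgf]
  have hrate : ∏ i ∈ s.erase j, ∫⁻ b, f i b ∂ν i ≤
      ENNReal.ofReal (chernoffRate h) ^ (s.card - 1) := by
    rw [← Finset.card_erase_of_mem hj]
    refine Finset.prod_le_pow_card _ _ _ fun i hi => ?_
    simp only [f, if_neg (Finset.ne_of_mem_erase hi), one_mul]
    exact lintegral_labelMgf_le h0 hh (hν i (Finset.mem_of_mem_erase hi))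
  have hrate0 : 0 ≤ chernoffRate h := div_nonneg (by nlinarith) (by nlinarith)
  rw [lintegral_congr hf, lintegral_pi_finsetProd ν s fun _ => Measurable.of_discrete,
    ← Finset.mul_prod_erase s _ hj, hfj, mul_right_comm,
    ENNReal.ofReal_mul (inv_nonneg.2 (by linarith)), ENNReal.ofReal_pow hrate0]
  gcongr

end LabelChernoff

/-! ### The uniform distribution on a convex body -/

section UniformDistribution

theorem tendsto_pi_measure_not_subset_iUnion_ball {X : Type*} [PseudoMetricSpace X]
    [MeasurableSpace X] [OpensMeasurableSpace X] {μ : Measure X} [IsProbabilityMeasure μ]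
    {A : Set X} (hA : TotallyBounded A) (hAμ : A ⊆ μ.support) {r : ℝ} (hr : 0 < r) :
    Tendsto (fun n => (Measure.pi fun _ : Fin n => μ) {x | ¬ A ⊆ ⋃ i, Metric.ball (x i) r}) atTop
      (𝓝 0) := by
  obtain ⟨Q, hQA, hQ, hcover⟩ := Metric.finite_approx_of_totallyBounded hA (r / 2) (half_pos hr)
  lift Q to Finset X using hQ
  have hmissed : ∀ n, {x : Fin n → X | ¬ A ⊆ ⋃ i, Metric.ball (x i) r} ⊆
      ⋃ q ∈ Q, univ.pi fun _ => (Metric.ball q (r / 2))ᶜ := by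
    intro n x hx
    obtain ⟨p, hp, hfar⟩ := not_subset.1 hx
    obtain ⟨q, hq, hpq⟩ := mem_iUnion₂.1 (hcover hp)
    refine mem_iUnion₂.2 ⟨q, hq, fun i _ hi => hfar (mem_iUnion.2 ⟨i, ?_⟩)⟩
    calc dist p (x i) ≤ dist p q + dist (x i) q := dist_triangle_right _ _ _
      _ < r / 2 + r / 2 := add_lt_add hpq hi
      _ = r := add_halves r
  have hbound : ∀ n, (Measure.pi fun _ : Fin n => μ) {x | ¬ A ⊆ ⋃ i, Metric.ball (x i) r} ≤
      ∑ q ∈ Q, μ (Metric.ball q (r / 2))ᶜ ^ n := fun n =>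
    calc _ ≤ ∑ q ∈ Q, (Measure.pi fun _ : Fin n => μ) (univ.pi fun _ => (Metric.ball q (r / 2))ᶜ) :=
          (measure_mono (hmissed n)).trans (measure_biUnion_finset_le _ _)
      _ = ∑ q ∈ Q, μ (Metric.ball q (r / 2))ᶜ ^ n := by simp [Measure.pi_pi]
  have hlim : Tendsto (fun n => ∑ q ∈ Q, μ (Metric.ball q (r / 2))ᶜ ^ n) atTop
      (𝓝 (∑ _q ∈ Q, 0)) := by
    refine tendsto_finsetSum _ fun q hq => ENNReal.tendsto_pow_atTop_nhds_zero_of_lt_one ?_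
    rw [prob_compl_eq_one_sub Metric.isOpen_ball.measurableSet]
    exact ENNReal.sub_lt_self ENNReal.one_ne_top one_ne_zero
      ((Measure.mem_support_iff_forall q).1 (hAμ (hQA hq)) _
        (Metric.ball_mem_nhds q (half_pos hr))).ne'
  rw [Finset.sum_const_zero] at hlim
  exact tendsto_of_tendsto_of_tendsto_of_le_of_le tendsto_const_nhds hlim (fun _ => zero_le) hbound

theorem support_cond_of_convex {V : Type*} [NormedAddCommGroup V] [NormedSpace ℝ V]
    [HereditarilyLindelofSpace V] [MeasurableSpace V] [OpensMeasurableSpace V] (μ : Measure V)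
    [IsFiniteMeasureOnCompacts μ] [μ.IsOpenPosMeasure] {K : Set V} (hK : IsCompact K)
    (hconv : Convex ℝ K) (hint : (interior K).Nonempty) : (μ[|K]).support = K := by
  refine subset_antisymm (Measure.support_subset_of_isClosed hK.isClosed
    (ae_cond_mem hK.measurableSet)) fun p hp => (Measure.mem_support_iff_forall p).2 fun U hU => ?_
  have hclosure : p ∈ closure (interior K) := by
    rw [hconv.closure_interior_eq_closure_of_nonempty_interior hint]
    exact subset_closure hp
  have hpos : 0 < μ (interior U ∩ interior K) :=
    (isOpen_interior.inter isOpen_interior).measure_pos μ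
      (mem_closure_iff.1 hclosure _ isOpen_interior (mem_interior_iff_mem_nhds.2 hU))
  rw [cond_apply hK.measurableSet]
  refine ENNReal.mul_pos (ENNReal.inv_ne_zero.2 hK.measure_lt_top.ne) (hpos.trans_le ?_).ne'
  exact measure_mono fun q hq => ⟨interior_subset hq.2, interior_subset hq.1⟩

variable {d : ℕ} {K : Set (E d)} {η : E d → ℝ}

/-- The points within distance `2 * r` of the complement of `K` or of the class boundary for the
uniform distribution on `K`. -/
def boundaryLayer (K : Set (E d)) (η : E d → ℝ) (r : ℝ) : Set (E d) :=
  Metric.cthickening (2 * r) (Kᶜ ∪ classBoundary (volume[|K]) η)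

theorem measurableSet_boundaryLayer (K : Set (E d)) (η : E d → ℝ) (r : ℝ) :
    MeasurableSet (boundaryLayer K η r) :=
  Metric.isClosed_cthickening.measurableSet

theorem closedBall_subset_of_notMem_boundaryLayer {r : ℝ} {p : E d}
    (hp : p ∉ boundaryLayer K η r) : Metric.closedBall p (2 * r) ⊆ K := by
  by_contra hsub
  obtain ⟨q, hq, hqK⟩ := not_subset.1 hsub
  exact hp (Metric.mem_cthickening_of_dist_le p q _ _ (Or.inl hqK) (Metric.mem_closedBall'.1 hq))

theorem tendsto_measure_boundaryLayer (hK : IsCompact K) (hconv : Convex ℝ K)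
    (hnull : (volume[|K]) (classBoundary (volume[|K]) η) = 0) :
    Tendsto (fun r => (volume[|K]) (boundaryLayer K η r)) (𝓝[>] 0) (𝓝 0) := by
  have hfrontier : (volume[|K]) (closure Kᶜ) = 0 := by
    rw [cond_apply hK.measurableSet]
    refine mul_eq_zero_of_right _ (measure_mono_null ?_ (hconv.addHaar_frontier volume))
    rw [frontier_eq_closure_inter_closure]
    exact inter_subset_inter_left _ subset_closure
  have hclosure : (volume[|K]) (closure (Kᶜ ∪ classBoundary (volume[|K]) η)) = 0 := by
    have hclosed : IsClosed (classBoundary (volume[|K]) η) :=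
      isClosed_closure.inter isClosed_closure
    rw [closure_union, hclosed.closure_eq]
    exact measure_union_null hfrontier hnull
  have hthick := tendsto_measure_cthickening (μ := volume[|K])
    (s := Kᶜ ∪ classBoundary (volume[|K]) η) ⟨1, one_pos, measure_ne_top _ _⟩
  rw [hclosure] at hthick
  refine hthick.comp (Tendsto.mono_left ?_ nhdsWithin_le_nhds)
  exact Continuous.tendsto' (continuous_const.mul continuous_id) 0 0 (mul_zero _)

theorem IsSimplePolytope.isCompact (hK : IsSimplePolytope K) :
    IsCompact K := by
  obtain ⟨V, hV, rfl⟩ := hK.polytope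
  exact hV.isCompact_convexHull ℝ

theorem IsSimplePolytope.convex (hK : IsSimplePolytope K) :
    Convex ℝ K := by
  obtain ⟨V, -, rfl⟩ := hK.polytope
  exact convex_convexHull ℝ V

theorem VanishingBoundary.measure_classBoundary_eq_zero {μ : Measure (E d)}
    (hvan : VanishingBoundary μ η) : μ (classBoundary μ η) = 0 := by
  refine le_antisymm (ge_of_tendsto hvan ?_) zero_le
  filter_upwards [self_mem_nhdsWithin] with r hr
  exact measure_mono fun p hp => ⟨p, hp, 0, Metric.mem_closedBall_self (le_of_lt hr), add_zero p⟩

theorem plugin_eq_one_iff {p : E d} : plugin η p = 1 ↔ 1 / 2 < η p := by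
  rw [plugin]
  split_ifs with h
  · exact iff_of_true rfl h
  · exact iff_of_false zero_ne_one h

theorem LipschitzAwayFromBoundary.uniformContinuousOn_classRegion {μ : Measure (E d)}
    (hL : LipschitzAwayFromBoundary μ η) {h : ℝ} (hm : HardMargin μ η h) (y : Fin 2) :
    UniformContinuousOn η (classRegion μ η y) := by
  obtain ⟨L, hbelow, habove⟩ := hL
  obtain rfl | rfl : y = 0 ∨ y = 1 := by omega
  · refine hbelow.uniformContinuousOn.mono fun p ⟨hp, hp0⟩ => ⟨hp, ?_⟩
    have hle : η p ≤ 1 / 2 := not_lt.1 fun hlt => by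
      rw [plugin_eq_one_iff.2 hlt] at hp0
      exact one_ne_zero hp0
    refine hle.lt_of_ne fun heq => hm.1.not_ge ?_
    simpa only [heq, sub_self, abs_zero] using hm.2 p hp
  · exact habove.uniformContinuousOn.mono fun p ⟨hp, hp1⟩ => ⟨hp, plugin_eq_one_iff.1 hp1⟩

end UniformDistribution

/-! ### Random labels at fixed points -/

section FixedPoints

/-- The points `x i` lie in `K`, and every point of `K` is at distance less than `r` from one of
them. -/
structure IsNet {ι X : Type*} [PseudoMetricSpace X] (K : Set X) (r : ℝ) (x : ι → X) : Prop where
  mem : ∀ i, x i ∈ K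
  subset_iUnion_ball : K ⊆ ⋃ i, Metric.ball (x i) r

/-- The bound for the relative excess risk of simplicial interpolation in dimension `d` under the
`h`-hard margin condition. -/
def excessFactor (d : ℕ) (h : ℝ) : ℝ := (1 - h)⁻¹ * chernoffRate h ^ d * (d + 1)

variable {d n : ℕ} {K : Set (E d)} {η : E d → ℝ} {r ε h : ℝ} {x : Fin n → E d}
  {T : Set (Finset (Fin n))} {s : Finset (Fin n)}

theorem IsNet.convexHull_subset (hx : IsNet K r x) (hconv : Convex ℝ K) (s : Finset (Fin n)) :
    convexHull ℝ (x '' s) ⊆ K :=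
  convexHull_min (image_subset_iff.2 fun i _ => hx.mem i) hconv

theorem IsNet.closedBall_subset_iUnion_ball (hx : IsNet K r x) (hr : 0 ≤ r) {p : E d}
    (hp : p ∉ boundaryLayer K η r) : Metric.closedBall p r ⊆ ⋃ i, Metric.ball (x i) r :=
  calc Metric.closedBall p r ⊆ Metric.closedBall p (2 * r) :=
        Metric.closedBall_subset_closedBall (by linarith)
    _ ⊆ K := closedBall_subset_of_notMem_boundaryLayer hp
    _ ⊆ ⋃ i, Metric.ball (x i) r := hx.subset_iUnion_ball

theorem measurableSet_convexHull_image (x : Fin n → E d) (s : Finset (Fin n)) :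
    MeasurableSet (convexHull ℝ (x '' s)) :=
  ((s.finite_toSet.image x).isCompact_convexHull ℝ).measurableSet

theorem IsDelaunayTriangulation.dist_le_and_plugin_eq (hT : IsDelaunayTriangulation x T)
    (hK : IsCompact K) (hconv : Convex ℝ K) (hint : (interior K).Nonempty) (hx : IsNet K r x)
    (hr : 0 ≤ r) (hs : s ∈ T) {p q : E d} (hp : p ∈ convexHull ℝ (x '' s))
    (hpB : p ∉ boundaryLayer K η r) (hq : q ∈ convexHull ℝ (x '' s)) :
    dist p q ≤ 2 * r ∧ plugin η q = plugin η p := by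
  have hdist := hT.dist_le hr hs (hx.closedBall_subset_iUnion_ball hr hpB) hp hp hq
  have hsupport := support_cond_of_convex volume hK hconv hint
  refine ⟨hdist, plugin_eq_of_notMem_cthickening (hsupport.symm ▸ hconv) ?_ ?_ hdist fun hmem =>
    hpB (Metric.cthickening_subset_of_subset _ subset_union_right hmem)⟩
  · exact hsupport.symm ▸ hx.convexHull_subset hconv s hp
  · exact hsupport.symm ▸ hx.convexHull_subset hconv s hq

theorem sum_bayesError_mul_measure_simplex_le (hT : IsDelaunayTriangulation x T)
    (hK : IsCompact K) (hconv : Convex ℝ K) (hint : (interior K).Nonempty) (hx : IsNet K r x)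
    (hr : 0 ≤ r)
    (hosc : ∀ p ∈ K, ∀ q ∈ K, plugin η p = plugin η q → dist p q ≤ 2 * r → |η p - η q| ≤ ε)
    (hs : s ∈ T) :
    (∑ j ∈ s, bayesError η (x j)) * (volume[|K]) (convexHull ℝ (x '' s)) ≤
      (d + 1) * ∫⁻ p in convexHull ℝ (x '' s),
        (bayesError η p + ENNReal.ofReal ε + (boundaryLayer K η r).indicator 1 p) ∂volume[|K] := by
  have hvertex : ∀ j ∈ s, ∀ p ∈ convexHull ℝ (x '' s), bayesError η (x j) ≤
      bayesError η p + ENNReal.ofReal ε + (boundaryLayer K η r).indicator 1 p := by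
    intro j hj p hp
    by_cases hpB : p ∈ boundaryLayer K η r
    · rw [indicator_of_mem hpB]
      exact (bayesError_le_one η _).trans le_add_self
    · have hjs := subset_convexHull ℝ _ (mem_image_of_mem x hj)
      obtain ⟨hdist, hplugin⟩ := hT.dist_le_and_plugin_eq hK hconv hint hx hr hs hp hpB hjs
      exact (bayesError_le_add (hosc _ (hx.mem j) p (hx.convexHull_subset hconv s hp) hplugin
        (dist_comm p _ ▸ hdist))).trans le_self_add
  calc _ ≤ ∑ _j ∈ s, ∫⁻ p in convexHull ℝ (x '' s), (bayesError η p + ENNReal.ofReal ε +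
          (boundaryLayer K η r).indicator 1 p) ∂volume[|K] := by
        rw [Finset.sum_mul]
        refine Finset.sum_le_sum fun j hj => ?_
        rw [← setLIntegral_const]
        exact setLIntegral_mono' (measurableSet_convexHull_image x s) (hvertex j hj)
    _ = _ := by rw [Finset.sum_const, hT.card_eq s hs, nsmul_eq_mul, Nat.cast_succ]

theorem tsum_bayesError_mul_measure_simplex_le (hT : IsDelaunayTriangulation x T)
    (hK : IsCompact K) (hconv : Convex ℝ K) (hint : (interior K).Nonempty) (hx : IsNet K r x)
    (hr : 0 ≤ r)
    (hosc : ∀ p ∈ K, ∀ q ∈ K, plugin η p = plugin η q → dist p q ≤ 2 * r → |η p - η q| ≤ ε) :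
    ∑' s : T, (∑ j ∈ s.1, bayesError η (x j)) * (volume[|K]) (convexHull ℝ (x '' s.1)) ≤
      (d + 1) * (∫⁻ p, bayesError η p ∂volume[|K] + ENNReal.ofReal ε +
        (volume[|K]) (boundaryLayer K η r)) := by
  have hB := measurableSet_boundaryLayer K η r
  let φ : E d → ℝ≥0∞ := fun p =>
    bayesError η p + ENNReal.ofReal ε + (boundaryLayer K η r).indicator 1 p
  calc _ ≤ ∑' s : T, (d + 1) * ∫⁻ p in convexHull ℝ (x '' s.1), φ p ∂volume[|K] :=
        ENNReal.tsum_le_tsum fun s =>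
          sum_bayesError_mul_measure_simplex_le hT hK hconv hint hx hr hosc s.2
    _ = (d + 1) * ∫⁻ p in ⋃ s ∈ T, convexHull ℝ (x '' s), φ p ∂volume[|K] := by
        rw [ENNReal.tsum_mul_left, lintegral_biUnion₀ T.to_countable
          fun s _ => (measurableSet_convexHull_image x s).nullMeasurableSet]
        exact fun s hs t ht hst => cond_absolutelyContinuous (hT.volume_inter_eq_zero hs ht hst)
    _ ≤ (d + 1) * ∫⁻ p, φ p ∂volume[|K] := by
        gcongr
        exact Measure.restrict_le_self
    _ ≤ _ := by
        rw [lintegral_add_right _ (measurable_one.indicator hB),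
          lintegral_add_right _ measurable_const, lintegral_indicator_one hB, lintegral_const]
        gcongr
        exact mul_le_of_le_one_right zero_le prob_le_one

theorem measure_plugin_linearInterpolation_ne_le (hK : MeasurableSet K)
    (hsK : convexHull ℝ (x '' s) ⊆ K) (b : AffineBasis s ℝ (E d)) (hb : ∀ i, b i = x i)
    (y : Fin n → Fin 2) {t : ℝ} (ht : 0 ≤ t) (ht' : t < 1) {e : Fin 2}
    (hη : ∀ p ∈ convexHull ℝ (x '' s), plugin η p = e.rev) :
    (volume[|K]) {p ∈ convexHull ℝ (x '' s) |
        plugin (linearInterpolation x (fun i => label (y i)) s) p ≠ plugin η p} ≤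
      (∑ j ∈ s, (if y j = e then 1 else 0) * ∏ i ∈ s, labelMgf t e (y i)) *
        (volume[|K]) (convexHull ℝ (x '' s)) := by
  rw [cond_apply hK, cond_apply hK, inter_eq_right.2 hsK, mul_left_comm]
  gcongr
  refine (measure_mono ?_).trans (volume_plugin_linearInterpolation_eq_le b hb y e ht ht')
  rintro p ⟨-, hp, hne⟩
  refine ⟨hp, ?_⟩
  rw [hη p hp] at hne
  grind [Fin.rev]

theorem lintegral_measure_simplex_misclassified_le (hT : IsDelaunayTriangulation x T)
    (hK : IsCompact K) (hconv : Convex ℝ K) (hint : (interior K).Nonempty) (hx : IsNet K r x)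
    (hr : 0 ≤ r) (hm : HardMargin (volume[|K]) η h) (hh : h ≤ 1 / 2)
    {ν : Fin n → Measure (Fin 2)} [∀ i, IsProbabilityMeasure (ν i)]
    (hν : ∀ i, (ν i).real {1} = η (x i)) (hs : s ∈ T) :
    ∫⁻ y, (volume[|K]) {p ∈ convexHull ℝ (x '' s) \ boundaryLayer K η r |
        plugin (linearInterpolation x (fun i => label (y i)) s) p ≠ plugin η p} ∂Measure.pi ν ≤
      ENNReal.ofReal ((1 - h)⁻¹ * chernoffRate h ^ d) *
        ((∑ j ∈ s, bayesError η (x j)) * (volume[|K]) (convexHull ℝ (x '' s))) := by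
  obtain hsB | ⟨p₀, hp₀, hp₀B⟩ := (convexHull ℝ (x '' s) \ boundaryLayer K η r).eq_empty_or_nonempty
  · simp [hsB]
  obtain ⟨b, hb⟩ := hT.exists_affineBasis hs
  set e := (plugin η p₀).rev
  have hplugin : ∀ q ∈ convexHull ℝ (x '' s), plugin η q = e.rev := fun q hq =>
    (hT.dist_le_and_plugin_eq hK hconv hint hx hr hs hp₀ hp₀B hq).2.trans (Fin.rev_rev _).symm
  have herr : ∀ i ∈ s, ν i {e} = bayesError η (x i) := fun i hi => by
    rw [← measure_singleton_rev_plugin (hν i),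
      hplugin _ (subset_convexHull ℝ _ (mem_image_of_mem x hi)), Fin.rev_rev]
  calc _ ≤ ∫⁻ y, (∑ j ∈ s, (if y j = e then 1 else 0) * ∏ i ∈ s, labelMgf h e (y i)) *
          (volume[|K]) (convexHull ℝ (x '' s)) ∂Measure.pi ν :=
        lintegral_mono fun y => (measure_mono (inter_subset_inter_left _ sdiff_subset)).trans
          (measure_plugin_linearInterpolation_ne_le hK.measurableSet
            (hx.convexHull_subset hconv s) b hb y hm.1.le (by linarith) hplugin)
    _ ≤ ENNReal.ofReal ((1 - h)⁻¹ * chernoffRate h ^ (s.card - 1)) * (∑ j ∈ s, ν j {e}) *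
          (volume[|K]) (convexHull ℝ (x '' s)) := by
        rw [lintegral_mul_const _ Measurable.of_discrete]
        gcongr
        refine lintegral_sum_prod_labelMgf_le hm.1.le hh s fun i hi => ?_
        rw [herr i hi]
        exact hm.bayesError_le ((support_cond_of_convex volume hK hconv hint).ge (hx.mem i))
    _ = _ := by
        rw [hT.card_eq s hs, Nat.add_sub_cancel, Finset.sum_congr rfl herr, mul_assoc]

theorem measure_plugin_simplicialInterpolant_ne_le (hT : IsDelaunayTriangulation x T)
    (hx : IsNet K r x) (hr : 0 ≤ r) (y : Fin n → Fin 2) :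
    (volume[|K]) {p | plugin (simplicialInterpolant T x fun i => label (y i)) p ≠ plugin η p} ≤
      (volume[|K]) (boundaryLayer K η r) +
        ∑' s : T, (volume[|K]) {p ∈ convexHull ℝ (x '' s.1) \ boundaryLayer K η r |
          plugin (linearInterpolation x (fun i => label (y i)) s.1) p ≠ plugin η p} := by
  have hsub : {p | plugin (simplicialInterpolant T x fun i => label (y i)) p ≠ plugin η p} ⊆
      boundaryLayer K η r ∪ ⋃ s ∈ T, {p ∈ convexHull ℝ (x '' s) \ boundaryLayer K η r |
        plugin (linearInterpolation x (fun i => label (y i)) s) p ≠ plugin η p} := by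
    refine fun p hp => or_iff_not_imp_left.2 fun hpB => ?_
    have hhull := mem_convexHull_of_closedBall_subset_iUnion_ball hr
      (hx.closedBall_subset_iUnion_ball hr hpB)
    rw [← hT.cover] at hhull
    have hexists : ∃ s, s ∈ T ∧ p ∈ convexHull ℝ (x '' s) := by
      simpa only [mem_iUnion, exists_prop] using hhull
    obtain ⟨hs, hps⟩ := hexists.choose_spec
    have hval : simplicialInterpolant T x (fun i => label (y i)) p =
        linearInterpolation x (fun i => label (y i)) hexists.choose p := dif_pos hexists
    rw [mem_ofPred_eq, plugin, hval] at hp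
    exact mem_iUnion₂.2 ⟨_, hs, ⟨hps, hpB⟩, hp⟩
  exact (measure_mono hsub).trans ((measure_union_le _ _).trans
    (add_le_add_right (measure_biUnion_le _ T.to_countable _) _))

theorem lintegral_measure_plugin_simplicialInterpolant_ne_le (hT : IsDelaunayTriangulation x T)
    (hK : IsCompact K) (hconv : Convex ℝ K) (hint : (interior K).Nonempty) (hx : IsNet K r x)
    (hr : 0 ≤ r)
    (hosc : ∀ p ∈ K, ∀ q ∈ K, plugin η p = plugin η q → dist p q ≤ 2 * r → |η p - η q| ≤ ε)
    (hm : HardMargin (volume[|K]) η h) (hh : h ≤ 1 / 2)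
    {ν : Fin n → Measure (Fin 2)} [∀ i, IsProbabilityMeasure (ν i)]
    (hν : ∀ i, (ν i).real {1} = η (x i)) :
    ∫⁻ y, (volume[|K]) {p | plugin (simplicialInterpolant T x fun i => label (y i)) p ≠ plugin η p}
        ∂Measure.pi ν ≤
      (volume[|K]) (boundaryLayer K η r) + ENNReal.ofReal (excessFactor d h) *
        (∫⁻ p, bayesError η p ∂volume[|K] + ENNReal.ofReal ε +
          (volume[|K]) (boundaryLayer K η r)) := by
  calc _ ≤ ∫⁻ y, ((volume[|K]) (boundaryLayer K η r) +
          ∑' s : T, (volume[|K]) {p ∈ convexHull ℝ (x '' s.1) \ boundaryLayer K η r |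
            plugin (linearInterpolation x (fun i => label (y i)) s.1) p ≠ plugin η p})
          ∂Measure.pi ν :=
        lintegral_mono fun y => measure_plugin_simplicialInterpolant_ne_le hT hx hr y
    _ ≤ (volume[|K]) (boundaryLayer K η r) +
          ∑' s : T, ENNReal.ofReal ((1 - h)⁻¹ * chernoffRate h ^ d) *
            ((∑ j ∈ s.1, bayesError η (x j)) * (volume[|K]) (convexHull ℝ (x '' s.1))) := by
        rw [lintegral_add_left measurable_const, lintegral_const, measure_univ, mul_one,
          lintegral_tsum fun _ => Measurable.of_discrete.aemeasurable]
        gcongr with s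
        exact lintegral_measure_simplex_misclassified_le hT hK hconv hint hx hr hm hh hν s.2
    _ ≤ _ := by
        have hfactor : ENNReal.ofReal (excessFactor d h) =
            ENNReal.ofReal ((1 - h)⁻¹ * chernoffRate h ^ d) * (d + 1) := by
          rw [excessFactor, ENNReal.ofReal_mul' (by positivity),
            ENNReal.ofReal_add d.cast_nonneg zero_le_one, ENNReal.ofReal_natCast,
            ENNReal.ofReal_one]
        rw [ENNReal.tsum_mul_left, hfactor, mul_assoc]
        gcongr
        exact tsum_bayesError_mul_measure_simplex_le hT hK hconv hint hx hr hosc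

end FixedPoints

/-! ### The expected risk -/

section ExpectedRisk

theorem lintegral_le_add_measure {α : Type*} [MeasurableSpace α] {μ : Measure α}
    [IsProbabilityMeasure μ] {f : α → ℝ≥0∞} {C : ℝ≥0∞} {s : Set α} (hf : ∀ᵐ x ∂μ, f x ≤ 1)
    (hC : ∀ᵐ x ∂μ, x ∉ s → f x ≤ C) : ∫⁻ x, f x ∂μ ≤ C + μ s := by
  have hs : MeasurableSet (toMeasurable μ s) := measurableSet_toMeasurable μ s
  calc ∫⁻ x, f x ∂μ ≤ ∫⁻ x, (C + (toMeasurable μ s).indicator 1 x) ∂μ := by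
        refine lintegral_mono_ae ?_
        filter_upwards [hf, hC] with x hx hxC
        by_cases hxs : x ∈ toMeasurable μ s
        · rw [indicator_of_mem hxs]
          exact hx.trans le_add_self
        · exact (hxC fun h => hxs (subset_toMeasurable μ s h)).trans le_self_add
    _ = C + μ s := by
        rw [lintegral_add_left measurable_const, lintegral_const, measure_univ, mul_one,
          lintegral_indicator_one hs, measure_toMeasurable]

variable {d : ℕ} {K : Set (E d)} {η : E d → ℝ} {r ε h : ℝ} {P : Measure (E d × Fin 2)}
  [IsProbabilityMeasure P] {T : TriangulationScheme d}

theorem lintegral_risk_simplicialClassifier_le (hP : P.fst = volume[|K])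
    (hη : IsConditionalMean P η) {n : ℕ} {x : Fin n → E d}
    (hT : IsDelaunayTriangulation x (T n x)) (hK : IsCompact K) (hconv : Convex ℝ K)
    (hint : (interior K).Nonempty) (hx : IsNet K r x) (hr : 0 ≤ r)
    (hosc : ∀ p ∈ K, ∀ q ∈ K, plugin η p = plugin η q → dist p q ≤ 2 * r → |η p - η q| ≤ ε)
    (hm : HardMargin P.fst η h) (hh : h ≤ 1 / 2) {ν : Fin n → Measure (Fin 2)}
    [∀ i, IsProbabilityMeasure (ν i)] (hν : ∀ i, (ν i).real {1} = η (x i)) :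
    ∫⁻ y, risk P (simplicialClassifier T fun i => (x i, y i)) ∂Measure.pi ν ≤
      risk P (plugin η) + (P.fst (boundaryLayer K η r) + ENNReal.ofReal (excessFactor d h) *
        (risk P (plugin η) + ENNReal.ofReal ε + P.fst (boundaryLayer K η r))) := by
  calc _ ≤ ∫⁻ y, (risk P (plugin η) + P.fst {p |
          plugin (simplicialInterpolant (T n x) x fun i => label (y i)) p ≠ plugin η p})
          ∂Measure.pi ν := lintegral_mono fun y => risk_le_risk_add
    _ ≤ _ := by
        rw [lintegral_add_left measurable_const, lintegral_const, measure_univ, mul_one,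
          hη.risk_plugin, hP]
        gcongr
        exact lintegral_measure_plugin_simplicialInterpolant_ne_le hT hK hconv hint hx hr hosc
          (hP ▸ hm) hh hν

theorem expectedRisk_le (hP : P.fst = volume[|K]) (hη : IsConditionalMean P η)
    (hT : T.IsDelaunay) (hK : IsCompact K) (hconv : Convex ℝ K) {p₀ : E d} (hr : 0 < r)
    (hp₀ : Metric.closedBall p₀ (2 * r) ⊆ K)
    (hosc : ∀ p ∈ K, ∀ q ∈ K, plugin η p = plugin η q → dist p q ≤ 2 * r → |η p - η q| ≤ ε)
    (hm : HardMargin P.fst η h) (hh : h ≤ 1 / 2) (n : ℕ) :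
    expectedRisk P T n ≤
      risk P (plugin η) + (P.fst (boundaryLayer K η r) + ENNReal.ofReal (excessFactor d h) *
        (risk P (plugin η) + ENNReal.ofReal ε + P.fst (boundaryLayer K η r))) +
      (Measure.pi fun _ : Fin n => P.fst) {x | ¬ K ⊆ ⋃ i, Metric.ball (x i) r} := by
  have hint : (interior K).Nonempty := ⟨p₀, interior_mono hp₀
    (Metric.ball_subset_interior_closedBall (Metric.mem_ball_self (by positivity)))⟩
  have hlabel : ∀ᵐ x ∂(Measure.pi fun _ : Fin n => P.fst),
      ∀ i, x i ∈ K ∧ (P.condKernel (x i)).real {1} = η (x i) := by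
    have hK_ae : ∀ᵐ p ∂P.fst, p ∈ K := hP ▸ ae_cond_mem hK.measurableSet
    exact ae_all_iff.2 fun i => (Measure.quasiMeasurePreserving_eval (fun _ : Fin n => P.fst) i).ae
      (hK_ae.and hη.condKernel_real_singleton_one)
  have hdisintegrate := lintegral_pi_compProd_le P.fst P.condKernel
    (F := fun z : Fin n → E d × Fin 2 => risk P (simplicialClassifier T z))
    fun _ => Measurable.of_discrete
  rw [P.disintegrate P.condKernel] at hdisintegrate
  refine hdisintegrate.trans (lintegral_le_add_measure (ae_of_all _ fun x => ?_) ?_)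
  · exact (lintegral_mono fun _ => prob_le_one).trans_eq (by simp)
  · filter_upwards [hlabel] with x hx hxK
    have hcover : K ⊆ ⋃ i, Metric.ball (x i) r := not_not.1 hxK
    have hspan := affineSpan_eq_top_of_closedBall_subset_iUnion_ball hr (hp₀.trans hcover)
    exact lintegral_risk_simplicialClassifier_le hP hη (hT n x hspan) hK hconv hint
      ⟨fun i => (hx i).1, hcover⟩ hr.le hosc hm hh fun i => (hx i).2

theorem eventually_abs_sub_le_of_uniformContinuousOn_classRegion {μ : Measure (E d)}
    (hη : ∀ y, UniformContinuousOn η (classRegion μ η y)) (hε : 0 < ε) :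
    ∀ᶠ r in 𝓝[>] 0, ∀ p ∈ μ.support, ∀ q ∈ μ.support, plugin η p = plugin η q →
      dist p q ≤ 2 * r → |η p - η q| ≤ ε := by
  have hclass : ∀ y, ∀ᶠ r in 𝓝[>] 0, ∀ p ∈ classRegion μ η y, ∀ q ∈ classRegion μ η y,
      dist p q ≤ 2 * r → |η p - η q| ≤ ε := by
    intro y
    obtain ⟨δ, hδ, hclose⟩ := Metric.uniformContinuousOn_iff_le.1 (hη y) ε hε
    filter_upwards [Ioo_mem_nhdsGT (half_pos hδ)] with r hr p hp q hq hpq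
    exact hclose p hp q hq (hpq.trans (by linarith [hr.2]))
  filter_upwards [eventually_all.2 hclass] with r hr p hp q hq hpq
  exact hr (plugin η q) p ⟨hp, hpq⟩ q ⟨hq, rfl⟩

theorem eventually_limsup_expectedRisk_le (hP : P.fst = volume[|K]) (hη : IsConditionalMean P η)
    (hT : T.IsDelaunay) (hK : IsCompact K) (hconv : Convex ℝ K) (hint : (interior K).Nonempty)
    (hm : HardMargin P.fst η h) (hh : h ≤ 1 / 2)
    (hcont : ∀ y, UniformContinuousOn η (classRegion P.fst η y)) (hε : 0 < ε) :
    ∀ᶠ r in 𝓝[>] 0, limsup (fun n => expectedRisk P T n) atTop ≤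
      risk P (plugin η) + (P.fst (boundaryLayer K η r) + ENNReal.ofReal (excessFactor d h) *
        (risk P (plugin η) + ENNReal.ofReal ε + P.fst (boundaryLayer K η r))) := by
  have hsupport : P.fst.support = K := hP ▸ support_cond_of_convex volume hK hconv hint
  obtain ⟨p₀, hp₀⟩ := hint
  obtain ⟨δ, hδ, hball⟩ := Metric.mem_nhds_iff.1 (mem_interior_iff_mem_nhds.1 hp₀)
  have hosc := eventually_abs_sub_le_of_uniformContinuousOn_classRegion hcont hε
  rw [hsupport] at hosc
  filter_upwards [hosc, Ioo_mem_nhdsGT (half_pos hδ)] with r hr ⟨hr0, hrδ⟩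
  have hp₀r : Metric.closedBall p₀ (2 * r) ⊆ K :=
    (Metric.closedBall_subset_ball (by linarith)).trans hball
  have hcover := tendsto_pi_measure_not_subset_iUnion_ball hK.totallyBounded hsupport.ge hr0
  have hbound := hcover.const_add (risk P (plugin η) + (P.fst (boundaryLayer K η r) +
    ENNReal.ofReal (excessFactor d h) *
      (risk P (plugin η) + ENNReal.ofReal ε + P.fst (boundaryLayer K η r))))
  rw [add_zero] at hbound
  rw [← hbound.limsup_eq]
  exact limsup_le_limsup (Eventually.of_forall fun n =>
    expectedRisk_le hP hη hT hK hconv hr0 hp₀r hr hm hh n)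

theorem limsup_expectedRisk_le (hP : P.fst = volume[|K]) (hη : IsConditionalMean P η)
    (hT : T.IsDelaunay) (hK : IsCompact K) (hconv : Convex ℝ K) (hint : (interior K).Nonempty)
    (hm : HardMargin P.fst η h) (hh : h ≤ 1 / 2)
    (hcont : ∀ y, UniformContinuousOn η (classRegion P.fst η y))
    (hnull : P.fst (classBoundary P.fst η) = 0) :
    limsup (fun n => expectedRisk P T n) atTop ≤
      risk P (plugin η) * (1 + ENNReal.ofReal (excessFactor d h)) := by
  have hlayer : Tendsto (fun r => P.fst (boundaryLayer K η r)) (𝓝[>] 0) (𝓝 0) := by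
    rw [hP] at hnull ⊢
    exact tendsto_measure_boundaryLayer hK hconv hnull
  have hmul {α : Type} {l : Filter α} {f : α → ℝ≥0∞} {a : ℝ≥0∞} (hf : Tendsto f l (𝓝 a)) :=
    ENNReal.Tendsto.const_mul hf (.inr (ENNReal.ofReal_ne_top (r := excessFactor d h)))
  have hle : ∀ ε > 0, limsup (fun n => expectedRisk P T n) atTop ≤ risk P (plugin η) +
      (0 + ENNReal.ofReal (excessFactor d h) * (risk P (plugin η) + ENNReal.ofReal ε + 0)) :=
    fun ε hε => ge_of_tendsto ((hlayer.add (hmul (hlayer.const_add _))).const_add _)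
      (eventually_limsup_expectedRisk_le hP hη hT hK hconv hint hm hh hcont hε)
  simp only [zero_add, add_zero] at hle
  have hε : Tendsto ENNReal.ofReal (𝓝[>] 0) (𝓝 0) := by
    rw [← ENNReal.ofReal_zero]
    exact ENNReal.continuous_ofReal.continuousWithinAt.tendsto
  calc limsup (fun n => expectedRisk P T n) atTop
      ≤ risk P (plugin η) + ENNReal.ofReal (excessFactor d h) * (risk P (plugin η) + 0) :=
        ge_of_tendsto ((hmul (hε.const_add _)).const_add _)
          (eventually_nhdsWithin_of_forall fun ε hε => hle ε hε)
    _ = risk P (plugin η) * (1 + ENNReal.ofReal (excessFactor d h)) := by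
        rw [add_zero, mul_one_add, mul_comm]

end ExpectedRisk

/-! ### The rate in the dimension -/

section Rate

theorem exists_add_one_mul_pow_le_exp {ρ : ℝ} (hρ : 0 < ρ) (hρ' : ρ < 1) :
    ∃ C c : ℝ, 0 < C ∧ 0 < c ∧ ∀ d : ℕ, ρ ^ d * (d + 1) ≤ C * Real.exp (-c * d) := by
  have hlog := Real.log_neg hρ hρ'
  set c := -Real.log ρ / 2 with hc
  have hc0 : 0 < c := by linarith
  refine ⟨1 + c⁻¹, c, by positivity, hc0, fun d => ?_⟩
  have hlinear : (d : ℝ) + 1 ≤ (1 + c⁻¹) * Real.exp (c * d) :=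
    calc (d : ℝ) + 1 ≤ c * d + 1 + d + c⁻¹ := by
          linarith [show 0 ≤ c * d by positivity, inv_pos.2 hc0]
      _ = (1 + c⁻¹) * (c * d + 1) := by field_simp; ring
      _ ≤ (1 + c⁻¹) * Real.exp (c * d) := by gcongr; exact Real.add_one_le_exp _
  calc ρ ^ d * (d + 1) ≤ Real.exp (d * Real.log ρ) * ((1 + c⁻¹) * Real.exp (c * d)) := by
        rw [Real.exp_nat_mul, Real.exp_log hρ]
        gcongr
    _ = (1 + c⁻¹) * Real.exp (-c * d) := by
        rw [mul_left_comm, ← Real.exp_add, hc]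
        ring_nf

theorem exists_excessFactor_le {h : ℝ} (h0 : 0 < h) (hh : h ≤ 1 / 2) :
    ∃ c₁ c₂ : ℝ, 0 < c₁ ∧ 0 < c₂ ∧ ∀ d : ℕ, excessFactor d h ≤ c₁ * Real.exp (-c₂ * d) := by
  have hsub : 0 < 1 - h ^ 2 := by nlinarith
  have hrate : 0 < chernoffRate h := div_pos (by nlinarith) hsub
  have hrate' : chernoffRate h < 1 := (div_lt_one hsub).2 (by nlinarith)
  obtain ⟨C, c, hC, hc, hle⟩ := exists_add_one_mul_pow_le_exp hrate hrate'
  have hinv : 0 < (1 - h)⁻¹ := inv_pos.2 (by linarith)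
  refine ⟨(1 - h)⁻¹ * C, c, mul_pos hinv hC, hc, fun d => ?_⟩
  rw [excessFactor, mul_assoc, mul_assoc]
  exact mul_le_mul_of_nonneg_left (hle d) hinv.le

end Rate

theorem mainTheorem5_general (h : ℝ) (hh : 0 < h) :
    ∃ c₁ c₂ : ℝ, 0 < c₁ ∧ 0 < c₂ ∧
      ∀ (d : ℕ) (K : Set (E d)), IsCompact K → Convex ℝ K → (interior K).Nonempty →
      ∀ (P : Measure (E d × Fin 2)), IsProbabilityMeasure P → P.fst = volume[|K] →
      ∀ (η : E d → ℝ), IsConditionalMean P η →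
        HardMargin P.fst η h →
        (∀ y, UniformContinuousOn η (classRegion P.fst η y)) →
        P.fst (classBoundary P.fst η) = 0 →
      ∀ (T : TriangulationScheme d), T.IsDelaunay →
        limsup (fun n : ℕ => expectedRisk P T n) atTop
          ≤ risk P (plugin η) * ENNReal.ofReal (1 + c₁ * Real.exp (-c₂ * d)) := by
  have hmin : 0 < min h (1 / 2) := lt_min hh one_half_pos
  obtain ⟨c₁, c₂, hc₁, hc₂, hle⟩ := exists_excessFactor_le hmin (min_le_right h (1 / 2))
  refine ⟨c₁, c₂, hc₁, hc₂, fun d K hK hconv hint P _ hP η hη hm hcont hnull T hT => ?_⟩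
  have hm' : HardMargin P.fst η (min h (1 / 2)) :=
    ⟨hmin, fun x hx => (min_le_left _ _).trans (hm.2 x hx)⟩
  calc limsup (fun n => expectedRisk P T n) atTop
      ≤ risk P (plugin η) * (1 + ENNReal.ofReal (excessFactor d (min h (1 / 2)))) :=
        limsup_expectedRisk_le hP hη hT hK hconv hint hm' (min_le_right _ _) hcont hnull
    _ ≤ risk P (plugin η) * ENNReal.ofReal (1 + c₁ * Real.exp (-c₂ * d)) := by
        rw [ENNReal.ofReal_add zero_le_one (by positivity), ENNReal.ofReal_one]
        gcongr
        exact hle d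

end SimplicialInterpolation

end

open SimplicialInterpolation in
theorem mainTheorem5 (h : ℝ) (hh : 0 < h) :
    ∃ c₁ c₂ : ℝ, 0 < c₁ ∧ 0 < c₂ ∧
      ∀ (d : ℕ), 1 ≤ d →
      ∀ (K : Set (E d)), IsSimplePolytope K →
      ∀ (P : Measure (E d × Fin 2)), IsProbabilityMeasure P → P.fst = volume[|K] →
      ∀ (η : E d → ℝ), IsConditionalMean P η →
        HardMargin P.fst η h →
        LipschitzAwayFromBoundary P.fst η →
        VanishingBoundary P.fst η →
      ∀ (T : TriangulationScheme d), T.IsDelaunay →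
        limsup (fun n : ℕ => expectedRisk P T n) atTop
          ≤ risk P (plugin η) * ENNReal.ofReal (1 + c₁ * Real.exp (-c₂ * d)) := by
  obtain ⟨c₁, c₂, hc₁, hc₂, hle⟩ := mainTheorem5_general h hh
  exact ⟨c₁, c₂, hc₁, hc₂, fun d _ K hK P hP hPK η hη hm hL hvan =>
    hle d K hK.isCompact hK.convex hK.fullDim P hP hPK η hη hm
      (hL.uniformContinuousOn_classRegion hm) hvan.measure_classBoundary_eq_zero⟩
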